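/- Let $\mathbf{k}$ be a field and let $\mathfrak{g}=\operatorname{Spec}(H)$ be a finite group scheme over $\mathbf{k}$, where $H$ is a finite-dimensional commutative Hopf algebra over $\mathbf{k}$ with comultiplication $\mu$ and counit $\pi$. A *$\mathfrak{g}$-field* is a field $K$ that is a $\mathbf{k}$-algebra, together with an action of $\mathfrak{g}$ on $\operatorname{Spec}(K)$, i.e. a $\mathbf{k}$-algebra map $\partial:K\to K\otimes_{\mathbf{k}}H$ such that $(\mathrm{id}\otimes\pi)\circ\partial=\mathrm{id}_K$ and $(\partial\otimes\mathrm{id})\circ\partial=(\mathrm{id}\otimes\mu)\circ\partial$. A *$\mathfrak{g}$-field extension* of $(K,\partial)$ is a $\mathfrak{g}$-field $(L,\partial')$ with a $\mathbf{k}$-algebra embedding $K\to L$ that commutes with $\partial$ and $\partial'$. The *field of constants* of $(K,\partial)$ is $K^{\mathfrak{g}}=\{x\in K : \partial(x)=x\otimes 1\}$. Fix a $\mathbf{k}$-basis $b_0,\dots,b_{e-1}$ of $H$ with $\pi(b_0)=1$ and $\pi(b_i)=0$ for $i>0$, and write $\partial(x)=\sum_{i<e}\partial_i(x)\otimes b_i$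 (so $\partial_0=\mathrm{id}$). Let $L_{\mathfrak{g}}$ be the language of rings expanded by unary function symbols for $\partial_1,\dots,\partial_{e-1}$ and by constant symbols for the elements of $\mathbf{k}$. A $\mathfrak{g}$-field $K$ is *existentially closed* if every quantifier-free $L_{\mathfrak{g}}$-formula $\varphi(x_1,\dots,x_n)$ with parameters from $K$ that has a realization in some $\mathfrak{g}$-field extension of $K$ has a realization in $K$. A field $M$ is *pseudo-algebraically closed (PAC)* if every absolutely irreducible affine variety over $M$ has an $M$-rational point; that is, for every $n$ and every ideal $I\subseteq M[X_1,\dots,X_n]$ that generates a prime ideal of $M^{\mathrm{alg}}[X_1,\dots,X_n]$, there is $a\in M^n$ with $f(a)=0$ for all $f\in I$. **Proposition.** If $K$ is an existentially closed $\mathfrak{g}$-field, then $K^{\mathfrak{g}}$ is a PAC field. -/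

import Mathlib

open scoped TensorProduct

universe u v w

namespace GroupSchemeField

/-- An action on `Spec R` of the finite group scheme `Spec H` over `k` (where `H` is a commutative
Hopf algebra over `k`), given by its coaction: a `k`-algebra map `R → R ⊗ H` that satisfies the
counit and the coassociativity conditions. -/
structure Action (k : Type u) [Field k] (H : Type v) [CommRing H] [HopfAlgebra k H]
    (R : Type w) [CommRing R] [Algebra k R] where
  /-- The coaction. -/
  del : R →ₐ[k] R ⊗[k] H
  counit_del : ∀ r : R,
    Algebra.TensorProduct.rid k k R
      (Algebra.TensorProduct.map (AlgHom.id k R) (Bialgebra.counitAlgHom k H) (del r)) = r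
  coassoc : ∀ r : R,
    Algebra.TensorProduct.assoc k k k R H H
        (Algebra.TensorProduct.map del (AlgHom.id k H) (del r)) =
      Algebra.TensorProduct.map (AlgHom.id k R) (Bialgebra.comulAlgHom k H) (del r)

section Basic

variable {k : Type u} [Field k] {H : Type v} [CommRing H] [HopfAlgebra k H]

/-- A `k`-algebra map that commutes with the actions. -/
def IsEquivariant {R S : Type w} [CommRing R] [Algebra k R] [CommRing S] [Algebra k S]
    (δ : Action k H R) (ε : Action k H S) (f : R →ₐ[k] S) : Prop :=
  ∀ r : R, ε.del (f r) = Algebra.TensorProduct.map f (AlgHom.id k H) (δ.del r)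

/-- The field of constants `{x | ∂ x = x ⊗ 1}` of a field with an action. -/
def Action.constants {K : Type w} [Field K] [Algebra k K] (δ : Action k H K) :
    IntermediateField k K where
  toSubalgebra :=
    AlgHom.equalizer δ.del (Algebra.TensorProduct.includeLeft : K →ₐ[k] K ⊗[k] H)
  inv_mem' := by
    intro x hx
    change δ.del x = x ⊗ₜ[k] (1 : H) at hx
    change δ.del x⁻¹ = x⁻¹ ⊗ₜ[k] (1 : H)
    rcases eq_or_ne x 0 with rfl | h
    · simp
    · have h1 : (x⁻¹ ⊗ₜ[k] (1 : H)) * δ.del x = 1 := by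
        rw [hx, Algebra.TensorProduct.tmul_mul_tmul, inv_mul_cancel₀ h, one_mul]
        rfl
      have h2 : δ.del x * δ.del x⁻¹ = 1 := by
        rw [← map_mul, mul_inv_cancel₀ h, map_one]
      calc δ.del x⁻¹ = (x⁻¹ ⊗ₜ[k] (1 : H)) * δ.del x * δ.del x⁻¹ := by rw [h1, one_mul]
        _ = x⁻¹ ⊗ₜ[k] (1 : H) := by rw [mul_assoc, h2, mul_one]

/-- The operators `∂_i` of an action: the coordinates of `∂ r = ∑ i, ∂_i r ⊗ b i` with respect to
a basis `b` of `H` over `k`. -/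
noncomputable def Action.op {R : Type w} [CommRing R] [Algebra k R] (δ : Action k H R)
    {ι : Type*} (b : Module.Basis ι k H) (i : ι) (r : R) : R :=
  (Algebra.TensorProduct.basis R b).repr (δ.del r) i

end Basic

/-- Function symbols added to the language of rings: a constant symbol for each element of `k`
and unary symbols for `∂_1, …, ∂_d`. -/
inductive OpFunctions (k : Type u) (d : ℕ) : ℕ → Type u
  | const : k → OpFunctions k d 0
  | op : Fin d → OpFunctions k d 1

/-- The language of the added symbols; it has no relation symbols besides equality. -/
def opLanguage (k : Type u) (d : ℕ) : FirstOrder.Language.{u, 0} where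
  Functions := OpFunctions k d
  Relations := fun _ => Empty

/-- The language of rings with `d` unary function symbols and with constants for the elements
of `k`. -/
abbrev language (k : Type u) (d : ℕ) : FirstOrder.Language :=
  FirstOrder.Language.ring.sum (opLanguage k d)

section ModelTheory

variable {k : Type u} [Field k] {H : Type v} [CommRing H] [HopfAlgebra k H] {d : ℕ}

/-- The interpretation of the added symbols in a ring with an action. The operator of index `0`
has no symbol: it is the identity when `b 0` has counit `1` and the other `b i` have counit `0`. -/
@[reducible] noncomputable def opStructure (b : Module.Basis (Fin (d + 1)) k H)
    {R : Type w} [CommRing R] [Algebra k R] (δ : Action k H R) : (opLanguage k d).Structure R where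
  funMap := fun {_} s =>
    match s with
    | OpFunctions.const c => fun _ => algebraMap k R c
    | OpFunctions.op i => fun x => δ.op b i.succ (x 0)
  RelMap := fun {_} r => Empty.elim r

/-- A ring with an action as a first-order structure; the ring symbols have their usual meaning. -/
@[reducible] noncomputable def structureOf (b : Module.Basis (Fin (d + 1)) k H)
    {R : Type w} [CommRing R] [Algebra k R] (δ : Action k H R) : (language k d).Structure R :=
  letI := FirstOrder.Ring.compatibleRingOfRing R
  letI := opStructure b δ
  inferInstance

/-- The field `K` with the action `δ` is existentially closed: every quantifier-free formula in
finitely many variables, with parameters from `K`, which has a solution in some extension `L` of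
`K` among the fields with an action has a solution in `K`. -/
def IsExistentiallyClosed (b : Module.Basis (Fin (d + 1)) k H)
    {K : Type w} [Field K] [Algebra k K] (δ : Action k H K) : Prop :=
  ∀ (L : Type w) [Field L] [Algebra k L] (ε : Action k H L) (f : K →ₐ[k] L),
    IsEquivariant δ ε f →
    ∀ (n : ℕ) (φ : (language k d).Formula (K ⊕ Fin n)),
      FirstOrder.Language.BoundedFormula.IsQF φ →
      (∃ y : Fin n → L,
        @FirstOrder.Language.Formula.Realize _ L (structureOf b ε) _ φ (Sum.elim f y)) →
      ∃ x : Fin n → K,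
        @FirstOrder.Language.Formula.Realize _ K (structureOf b δ) _ φ (Sum.elim id x)

end ModelTheory

/-- The field `M` is pseudo-algebraically closed: every absolutely irreducible affine variety over
`M` has an `M`-rational point. The variety is the zero set of an ideal of `M[X_1, …, X_n]` that
generates a prime ideal over the algebraic closure of `M`. -/
def IsPAC (M : Type w) [Field M] : Prop :=
  ∀ (n : ℕ) (I : Ideal (MvPolynomial (Fin n) M)),
    (I.map (MvPolynomial.map (σ := Fin n) (algebraMap M (AlgebraicClosure M)))).IsPrime →
    ∃ x : Fin n → M, ∀ f ∈ I, MvPolynomial.eval x f = 0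

end GroupSchemeField

/-! Let `M` be the field of constants of `K` and let `A = M[X]/I` be the coordinate ring of an
absolutely irreducible variety over `M`. The idea is to turn the generic point of the variety into a
tuple of constants in an extension of `K`.

Since `M^alg ⊗ A` is a domain, so is `K ⊗ A` (`isDomain_of_isDomain_algebraicClosure`). Let the
group scheme act on `K ⊗ A` through `K` and trivially on `A`; this is well defined over `M` because
`M` consists of constants (`Action.tensor`). The action extends to the fraction field `L` because `∂
r` becomes a unit of `L ⊗ H` for every `r ≠ 0` (`Action.isUnit_delTo`); this rests on the antipode
and on the finiteness of `H`.

In `L` the classes of the `X_i` are constants and satisfy the equations of `I`. Finitely many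
equations generate `I`, and being a constant is a finite system of equations `∂_i y = c_i y` with
`c_i` in `k` (`Action.del_eq_tmul_one_iff`). So one quantifier-free formula describes the situation,
and existential closedness gives a solution in `K`, whose coordinates are constants of `K`. -/

/-! ### Tensor products of domains over fields -/

/-- Nullstellensatz: a nonzero element of a finitely generated domain over an algebraically closed
field does not vanish at some rational point. -/
theorem IsAlgClosed.exists_algHom_apply_ne_zero {Ω B : Type*} [Field Ω] [IsAlgClosed Ω]
    [CommRing B] [IsDomain B] [Algebra Ω B] [Algebra.FiniteType Ω B] {b : B} (hb : b ≠ 0) :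
    ∃ φ : B →ₐ[Ω] Ω, φ b ≠ 0 := by
  -- A point of `B[1/b]` is a point of `B` at which `b` does not vanish. By Zariski's lemma the
  -- residue field at a maximal ideal of `B[1/b]` is finite over `Ω`, so it maps to `Ω`.
  let C := Localization.Away b
  have : Nontrivial C :=
    (IsLocalization.injective C (powers_le_nonZeroDivisors_of_noZeroDivisors hb)).nontrivial
  have : Algebra.FiniteType Ω C :=
    .trans (S := B) ‹_› (IsLocalization.finiteType_of_monoid_fg (Submonoid.powers b) C)
  obtain ⟨m, hm⟩ := Ideal.exists_maximal C
  let _ : Field (C ⧸ m) := Ideal.Quotient.field m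
  have : Module.Finite Ω (C ⧸ m) := finite_of_finite_type_of_isJacobsonRing Ω (C ⧸ m)
  let ψ : C ⧸ m →ₐ[Ω] Ω := IsAlgClosed.lift
  refine ⟨ψ.comp ((Ideal.Quotient.mkₐ Ω m).comp (IsScalarTower.toAlgHom Ω B C)), ?_⟩
  have h : IsUnit (algebraMap B C b) := IsLocalization.Away.algebraMap_isUnit b
  exact ((h.map (Ideal.Quotient.mkₐ Ω m)).map ψ).ne_zero

/-- Expand two nonzero elements in a basis of `E` over `Ω`, with coordinates in `B`. Some point of
`B` keeps one nonzero coordinate of each away from zero; specializing `B` at this point maps both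
elements to nonzero elements of the domain `E`, so their product is nonzero. -/
theorem Algebra.TensorProduct.isDomain_of_isAlgClosed (Ω E B : Type*) [Field Ω] [IsAlgClosed Ω]
    [CommRing E] [IsDomain E] [Algebra Ω E] [CommRing B] [IsDomain B] [Algebra Ω B]
    [Algebra.FiniteType Ω B] : IsDomain (E ⊗[Ω] B) := by
  have : NoZeroDivisors (E ⊗[Ω] B) := by
    let e := Module.Basis.ofVectorSpace Ω E
    let β := e.baseChange B
    let c := Algebra.TensorProduct.comm Ω E B
    -- Specializing along `φ` acts coordinatewise.
    have hev (φ : B →ₐ[Ω] Ω) (x : E ⊗[Ω] B) (i) :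
        e.repr (Algebra.TensorProduct.lift (AlgHom.id Ω E) ((Algebra.ofId Ω E).comp φ)
          (fun _ _ => .all _ _) x) i = φ (β.repr (c x) i) := by
      induction x with
      | zero => simp
      | add x y hx hy => simp_all
      | tmul x y =>
        rw [Algebra.TensorProduct.lift_tmul, mul_comm]
        simp [β, c, Algebra.ofId_apply, ← Algebra.smul_def, mul_comm (φ y)]
    refine ⟨fun {x y} hxy => ?_⟩
    by_contra! h
    obtain ⟨i, hi⟩ : ∃ i, β.repr (c x) i ≠ 0 := by
      by_contra! h0
      exact h.1 (c.injective (β.repr.injective (by ext i; simpa using h0 i)))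
    obtain ⟨j, hj⟩ : ∃ i, β.repr (c y) i ≠ 0 := by
      by_contra! h0
      exact h.2 (c.injective (β.repr.injective (by ext i; simpa using h0 i)))
    obtain ⟨φ, hφ⟩ := IsAlgClosed.exists_algHom_apply_ne_zero (Ω := Ω) (mul_ne_zero hi hj)
    rw [map_mul, ← hev, ← hev] at hφ
    have h0 := congr(Algebra.TensorProduct.lift (AlgHom.id Ω E) ((Algebra.ofId Ω E).comp φ)
          (fun _ _ => .all _ _) $hxy)
    rw [map_mul, map_zero] at h0
    rcases mul_eq_zero.mp h0 with h0 | h0 <;> simp [h0] at hφ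
  exact NoZeroDivisors.to_isDomain _

/-- A finitely generated algebra that becomes a domain over the algebraic closure becomes a domain
over every field extension. -/
theorem Algebra.TensorProduct.isDomain_of_isDomain_algebraicClosure (M A : Type*) [Field M] [CommRing A]
    [Algebra M A] [Algebra.FiniteType M A] [IsDomain (AlgebraicClosure M ⊗[M] A)]
    (K : Type*) [Field K] [Algebra M K] : IsDomain (K ⊗[M] A) := by
  let Ω := AlgebraicClosure M
  let E := AlgebraicClosure K
  let ι : Ω →ₐ[M] E := IsAlgClosed.lift
  let _ : Algebra Ω E := ι.toAlgebra
  have : IsScalarTower M Ω E := .of_algebraMap_eq fun x => (ι.commutes x).symm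
  have := isDomain_of_isAlgClosed Ω E (Ω ⊗[M] A)
  have : IsDomain (E ⊗[M] A) :=
    (Algebra.TensorProduct.cancelBaseChange M Ω Ω E A).symm.toMulEquiv.isDomain _
  -- By flatness over `M`, the inclusion of `K` in `E` stays injective after tensoring with `A`.
  exact Function.Injective.isDomain
    (Algebra.TensorProduct.map (IsScalarTower.toAlgHom M K E) (AlgHom.id M A)).toRingHom
    (Module.Flat.rTensor_preserves_injective_linearMap
      (IsScalarTower.toAlgHom M K E).toLinearMap (algebraMap K E).injective)

theorem MvPolynomial.isDomain_tensor_quotient {M σ : Type*} [Field M] (Ω : Type*) [Field Ω]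
    [Algebra M Ω] (I : Ideal (MvPolynomial σ M))
    [hI : (I.map (MvPolynomial.map (σ := σ) (algebraMap M Ω))).IsPrime] :
    IsDomain (Ω ⊗[M] (MvPolynomial σ M ⧸ I)) := by
  let e := MvPolynomial.algebraTensorAlgEquiv (σ := σ) M Ω
  have h : (I.map (MvPolynomial.map (σ := σ) (algebraMap M Ω))) =
      (I.map (Algebra.TensorProduct.includeRight : _ →ₐ[M] Ω ⊗[M] MvPolynomial σ M)).map
        (e : Ω ⊗[M] MvPolynomial σ M →+* MvPolynomial σ Ω) := by
    rw [← Ideal.map_coe Algebra.TensorProduct.includeRight, Ideal.map_map]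
    congr 1
    ext x <;> simp [e]
  exact ((Algebra.TensorProduct.tensorQuotientEquiv (R := M) M (MvPolynomial σ M) Ω I).toRingEquiv.trans
    (Ideal.quotientEquiv _ _ e.toRingEquiv h)).toMulEquiv.isDomain _

/-! ### Extending an action to the fraction field -/

namespace GroupSchemeField

namespace Action

open Algebra.TensorProduct (includeLeft includeRight)

variable {k : Type u} [Field k] {H : Type v} [CommRing H] [HopfAlgebra k H]
  {R : Type w} [CommRing R] [Algebra k R]

/-- The `H`-linear extension `r ⊗ h ↦ ∂ r * (1 ⊗ h)` of the coaction. -/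
noncomputable def shear (δ : Action k H R) : R ⊗[k] H →ₐ[k] R ⊗[k] H :=
  Algebra.TensorProduct.lift δ.del includeRight fun _ _ => .all _ _

/-- The inverse `r ⊗ h ↦ (id ⊗ S) (∂ r) * (1 ⊗ h)` of the shear map. -/
noncomputable def invShear (δ : Action k H R) : R ⊗[k] H →ₐ[k] R ⊗[k] H :=
  Algebra.TensorProduct.lift
    ((Algebra.TensorProduct.map (AlgHom.id k R) (HopfAlgebra.antipodeAlgHom k H)).comp δ.del)
    includeRight fun _ _ => .all _ _

variable (δ : Action k H R)

theorem map_algebraMap_counit_del (r : R) :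
    Algebra.TensorProduct.map (AlgHom.id k R)
      ((Algebra.ofId k H).comp (Bialgebra.counitAlgHom k H)) (δ.del r) = r ⊗ₜ 1 := by
  have h (t : R ⊗[k] H) : Algebra.TensorProduct.map (AlgHom.id k R)
      ((Algebra.ofId k H).comp (Bialgebra.counitAlgHom k H)) t =
      (includeLeft : R →ₐ[k] R ⊗[k] H) (Algebra.TensorProduct.rid k k R
        (Algebra.TensorProduct.map (AlgHom.id k R) (Bialgebra.counitAlgHom k H) t)) := by
    induction t with
    | zero => simp
    | add x y hx hy => simp_all [TensorProduct.add_tmul]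
    | tmul x y => simp [Algebra.ofId_apply, Algebra.algebraMap_eq_smul_one]
  rw [h, δ.counit_del, Algebra.TensorProduct.includeLeft_apply]

/-- Coassociativity turns the left side into `id ⊗ (f * g)` applied to `∂ r`, where `f * g` is the
convolution product; once this is trivial, the counit axiom applies. The relevant pairs are the
antipode and the identity, in either order. -/
theorem map_lift_assoc_map_del {f g : H →ₐ[k] H}
    (hfg : (Algebra.TensorProduct.lift f g fun _ _ => .all _ _).comp (Bialgebra.comulAlgHom k H) =
      (Algebra.ofId k H).comp (Bialgebra.counitAlgHom k H)) (r : R) :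
    Algebra.TensorProduct.map (AlgHom.id k R) (Algebra.TensorProduct.lift f g fun _ _ => .all _ _)
      (Algebra.TensorProduct.assoc k k k R H H
        (Algebra.TensorProduct.map δ.del (AlgHom.id k H) (δ.del r))) = r ⊗ₜ 1 := by
  rw [δ.coassoc, ← map_algebraMap_counit_del, ← hfg, ← AlgHom.comp_apply,
    ← Algebra.TensorProduct.map_comp, AlgHom.id_comp]

theorem shear_map_antipode (t : R ⊗[k] H) :
    δ.shear (Algebra.TensorProduct.map (AlgHom.id k R) (HopfAlgebra.antipodeAlgHom k H) t) =
    Algebra.TensorProduct.map (AlgHom.id k R)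
      (Algebra.TensorProduct.lift (AlgHom.id k H) (HopfAlgebra.antipodeAlgHom k H)
        fun _ _ => .all _ _)
      (Algebra.TensorProduct.assoc k k k R H H
        (Algebra.TensorProduct.map δ.del (AlgHom.id k H) t)) := by
  induction t with
  | zero => simp
  | add x y hx hy => simp_all
  | tmul x y =>
    simp only [shear, Algebra.TensorProduct.map_tmul, Algebra.TensorProduct.lift_tmul,
      AlgHom.id_apply]
    induction δ.del x with
    | zero => simp
    | add x y hx hy => simp_all [add_mul, TensorProduct.add_tmul]
    | tmul x y => simp

theorem invShear_eq (t : R ⊗[k] H) :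
    δ.invShear t =
    Algebra.TensorProduct.map (AlgHom.id k R)
      (Algebra.TensorProduct.lift (HopfAlgebra.antipodeAlgHom k H) (AlgHom.id k H)
        fun _ _ => .all _ _)
      (Algebra.TensorProduct.assoc k k k R H H
        (Algebra.TensorProduct.map δ.del (AlgHom.id k H) t)) := by
  induction t with
  | zero => simp
  | add x y hx hy => simp_all
  | tmul x y =>
    simp only [invShear, Algebra.TensorProduct.map_tmul, Algebra.TensorProduct.lift_tmul,
      AlgHom.comp_apply]
    induction δ.del x with
    | zero => simp
    | add x y hx hy => simp_all [add_mul, TensorProduct.add_tmul]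
    | tmul x y => simp

theorem invShear_del (r : R) : δ.invShear (δ.del r) = r ⊗ₜ 1 := by
  rw [invShear_eq, map_lift_assoc_map_del]
  ext h
  have := HopfAlgebra.mul_antipode_rTensor_comul_apply (R := k) h
  simp only [AlgHom.comp_apply, Bialgebra.comulAlgHom_apply, Bialgebra.counitAlgHom_apply,
    Algebra.ofId_apply, ← this]
  induction Coalgebra.comul (R := k) h with
  | zero => simp
  | add x y hx hy => simp_all
  | tmul x y => simp

theorem shear_invShear (t : R ⊗[k] H) : δ.shear (δ.invShear t) = t := by
  have hr (r : R) : δ.shear (δ.invShear (r ⊗ₜ 1)) = r ⊗ₜ 1 := by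
    rw [invShear, Algebra.TensorProduct.lift_tmul, map_one, mul_one, AlgHom.comp_apply,
      shear_map_antipode, map_lift_assoc_map_del]
    ext h
    have := HopfAlgebra.mul_antipode_lTensor_comul_apply (R := k) h
    simp only [AlgHom.comp_apply, Bialgebra.comulAlgHom_apply, Bialgebra.counitAlgHom_apply,
      Algebra.ofId_apply, ← this]
    induction Coalgebra.comul (R := k) h with
    | zero => simp
    | add x y hx hy => simp_all
    | tmul x y => simp
  have : δ.shear.comp δ.invShear = AlgHom.id k _ := by
    ext x
    · exact hr x
    · simp [shear, invShear]
  exact congr($this t)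

/-- `invShear` is injective, having `shear` as a left inverse, and it maps `∂ r` to `r ⊗ 1`. The
latter acts on the free `R`-module `R ⊗ H` as the scalar `r`, so it kills only zero. -/
theorem del_mem_nonZeroDivisors [IsDomain R] {r : R} (hr : r ≠ 0) :
    δ.del r ∈ nonZeroDivisors (R ⊗[k] H) := by
  rw [mem_nonZeroDivisors_iff_right]
  intro t ht
  have h : δ.invShear t * r ⊗ₜ 1 = 0 := by rw [← invShear_del, ← map_mul, ht, map_zero]
  have hs : r • δ.invShear t = 0 := by
    rw [Algebra.smul_def, mul_comm]; exact h
  rw [← δ.shear_invShear t, (smul_eq_zero.mp hs).resolve_left hr, map_zero]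

section FractionField

variable (L : Type w) [Field L] [Algebra k L] [Algebra R L] [IsScalarTower k R L]

/-- The coaction followed by the map to the fraction field. -/
noncomputable def delTo : R →ₐ[k] L ⊗[k] H :=
  (Algebra.TensorProduct.map (IsScalarTower.toAlgHom k R L) (AlgHom.id k H)).comp δ.del

variable [IsDomain R] [IsFractionRing R L]

omit [IsDomain R] in
theorem exists_smul_eq_map (t : L ⊗[k] H) : ∃ s : nonZeroDivisors R, ∃ t' : R ⊗[k] H,
    (s : R) • t =
      Algebra.TensorProduct.map (IsScalarTower.toAlgHom k R L) (AlgHom.id k H) t' := by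
  induction t with
  | zero => exact ⟨1, 0, by simp⟩
  | add x y hx hy =>
    obtain ⟨s, x', hx⟩ := hx
    obtain ⟨s', y', hy⟩ := hy
    have hm (r : R) (t : R ⊗[k] H) :
        Algebra.TensorProduct.map (IsScalarTower.toAlgHom k R L) (AlgHom.id k H) (r • t) =
        r • Algebra.TensorProduct.map (IsScalarTower.toAlgHom k R L) (AlgHom.id k H) t := by
      induction t with
      | zero => simp
      | add x y hx hy => simp_all
      | tmul x y => simp [Algebra.smul_def]
    refine ⟨s * s', (s' : R) • x' + (s : R) • y', ?_⟩
    rw [map_add, hm, hm, ← hx, ← hy, smul_add, smul_smul, smul_smul, Submonoid.coe_mul,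
      mul_comm (s : R)]
  | tmul x y =>
    obtain ⟨⟨r, s⟩, h⟩ := IsLocalization.surj (nonZeroDivisors R) x
    refine ⟨s, r ⊗ₜ y, ?_⟩
    simp [Algebra.smul_def, ← h, mul_comm]

/-- `L ⊗ H` is finite over `L`, hence artinian, so a non-zero-divisor is a unit. Clearing
denominators reduces the cancellation to `R ⊗ H`. -/
theorem isUnit_delTo [Module.Finite k H] (r : nonZeroDivisors R) : IsUnit (δ.delTo L r) := by
  have : IsArtinianRing (L ⊗[k] H) := IsArtinianRing.of_finite L _
  refine IsArtinianRing.isUnit_of_mem_nonZeroDivisors ?_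
  rw [mem_nonZeroDivisors_iff_right]
  intro t ht
  obtain ⟨s, t', h⟩ := exists_smul_eq_map (R := R) L t
  have hinj : Function.Injective
      (Algebra.TensorProduct.map (IsScalarTower.toAlgHom k R L) (AlgHom.id k H)) :=
    Module.Flat.rTensor_preserves_injective_linearMap
      (IsScalarTower.toAlgHom k R L).toLinearMap (IsFractionRing.injective R L)
  have h0 : t' * δ.del r = 0 := by
    apply hinj
    rw [map_mul, ← h, map_zero, smul_mul_assoc]
    exact (congrArg _ ht).trans (smul_zero _)
  have h1 : t' = 0 := (mem_nonZeroDivisors_iff_right.mp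
    (δ.del_mem_nonZeroDivisors (nonZeroDivisors.ne_zero r.2))) _ h0
  rw [h1, map_zero, ← algebraMap_smul L] at h
  refine (smul_eq_zero.mp h).resolve_left ?_
  simp

/-- The action on the fraction field of a domain with an action. -/
noncomputable def fractionField [Module.Finite k H] : Action k H L where
  del := IsLocalization.liftAlgHom (M := nonZeroDivisors R) (δ.isUnit_delTo L)
  counit_del := by
    intro x
    set D : L →ₐ[k] L ⊗[k] H := IsLocalization.liftAlgHom (M := nonZeroDivisors R) (δ.isUnit_delTo L)
    have hDr (r : R) : D (algebraMap R L r) = δ.delTo L r := by simp [D]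
    have h : (((Algebra.TensorProduct.rid k k L).toAlgHom.comp
        (Algebra.TensorProduct.map (AlgHom.id k L) (Bialgebra.counitAlgHom k H))).comp D) =
        AlgHom.id k L := by
      refine IsLocalization.algHom_ext (nonZeroDivisors R) ?_
      ext r
      have hr : Algebra.TensorProduct.rid k k L (Algebra.TensorProduct.map (AlgHom.id k L)
          (Bialgebra.counitAlgHom k H) (δ.delTo L r)) = algebraMap R L r := by
        conv_rhs => rw [← δ.counit_del r]
        rw [delTo, AlgHom.comp_apply]
        induction δ.del r with
        | zero => simp
        | add x y hx hy => simp_all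
        | tmul x y => simp [Algebra.smul_def, IsScalarTower.algebraMap_apply k R L]
      rw [← hDr] at hr
      exact hr
    exact congr($h x)
  coassoc := by
    intro x
    set D : L →ₐ[k] L ⊗[k] H := IsLocalization.liftAlgHom (M := nonZeroDivisors R) (δ.isUnit_delTo L)
      with hD
    have hDr (r : R) : D (algebraMap R L r) = δ.delTo L r := by simp [D]
    have h : ((Algebra.TensorProduct.assoc k k k L H H).toAlgHom.comp
        (Algebra.TensorProduct.map D (AlgHom.id k H))).comp D =
        (Algebra.TensorProduct.map (AlgHom.id k L) (Bialgebra.comulAlgHom k H)).comp D := by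
      refine IsLocalization.algHom_ext (nonZeroDivisors R) ?_
      ext r
      let j := IsScalarTower.toAlgHom k R L
      have h1 (t : R ⊗[k] H) : Algebra.TensorProduct.assoc k k k L H H
          (Algebra.TensorProduct.map D (AlgHom.id k H)
            (Algebra.TensorProduct.map j (AlgHom.id k H) t)) =
          Algebra.TensorProduct.map j (AlgHom.id k (H ⊗[k] H))
            (Algebra.TensorProduct.assoc k k k R H H
              (Algebra.TensorProduct.map δ.del (AlgHom.id k H) t)) := by
        induction t with
        | zero => simp
        | add x y hx hy => simp_all
        | tmul x y =>
          simp only [Algebra.TensorProduct.map_tmul, j, IsScalarTower.coe_toAlgHom', hDr, delTo,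
            AlgHom.comp_apply]
          induction δ.del x with
          | zero => simp
          | add x y hx hy => simp_all [TensorProduct.add_tmul]
          | tmul x y => simp
      have h2 (t : R ⊗[k] H) : Algebra.TensorProduct.map (AlgHom.id k L)
          (Bialgebra.comulAlgHom k H) (Algebra.TensorProduct.map j (AlgHom.id k H) t) =
          Algebra.TensorProduct.map j (AlgHom.id k (H ⊗[k] H))
            (Algebra.TensorProduct.map (AlgHom.id k R) (Bialgebra.comulAlgHom k H) t) := by
        induction t with
        | zero => simp
        | add x y hx hy => simp_all
        | tmul x y => simp
      change Algebra.TensorProduct.assoc k k k L H H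
          (Algebra.TensorProduct.map D (AlgHom.id k H) (D (algebraMap R L r))) =
        Algebra.TensorProduct.map (AlgHom.id k L) (Bialgebra.comulAlgHom k H)
          (D (algebraMap R L r))
      rw [hDr, delTo, AlgHom.comp_apply, h1, h2, δ.coassoc]
    exact congr($h x)

theorem fractionField_del_algebraMap [Module.Finite k H] (r : R) :
    (δ.fractionField L).del (algebraMap R L r) = δ.delTo L r := by
  simp [fractionField]

end FractionField

end Action

end GroupSchemeField

/-! ### The action on `K ⊗ A` that fixes `A` -/

namespace GroupSchemeField

namespace Action

open Algebra.TensorProduct (includeLeft includeRight)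

variable {k : Type u} [Field k] {H : Type v} [CommRing H] [HopfAlgebra k H]
  {K : Type w} [Field K] [Algebra k K] (δ : Action k H K)

theorem mem_constants {x : K} : x ∈ δ.constants ↔ δ.del x = x ⊗ₜ[k] (1 : H) := Iff.rfl

section Generated

variable {R : Type w} [CommRing R] [Algebra k R]

/-- A coaction on an algebra generated by the image of an algebra with an action, on which it
restricts to the given coaction, and by a set of elements that it fixes. -/
def ofGenerated {S : Type w} [CommRing S] [Algebra k S] (δ : Action k H S) (j : S →ₐ[k] R)
    (s : Set R) (hgen : Algebra.adjoin k (Set.range j ∪ s) = ⊤) (D : R →ₐ[k] R ⊗[k] H)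
    (hj : ∀ x, D (j x) = Algebra.TensorProduct.map j (AlgHom.id k H) (δ.del x))
    (hs : ∀ a ∈ s, D a = a ⊗ₜ 1) : Action k H R where
  del := D
  counit_del := by
    suffices h : ((Algebra.TensorProduct.rid k k R).toAlgHom.comp
        (Algebra.TensorProduct.map (AlgHom.id k R) (Bialgebra.counitAlgHom k H))).comp D =
        AlgHom.id k R from fun r => congr($h r)
    -- Both sides are algebra maps, so it suffices to compare them on the generators.
    refine AlgHom.ext_of_adjoin_eq_top hgen ?_
    rintro _ (⟨x, rfl⟩ | ha)
    · have h1 (t : S ⊗[k] H) : Algebra.TensorProduct.rid k k R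
          (Algebra.TensorProduct.map (AlgHom.id k R) (Bialgebra.counitAlgHom k H)
            (Algebra.TensorProduct.map j (AlgHom.id k H) t)) =
          j (Algebra.TensorProduct.rid k k S
            (Algebra.TensorProduct.map (AlgHom.id k S) (Bialgebra.counitAlgHom k H) t)) := by
        induction t with
        | zero => simp
        | add x y hx hy => simp_all
        | tmul x y => simp
      have h2 := h1 (δ.del x)
      rw [δ.counit_del, ← hj] at h2
      exact h2
    · simp [hs _ ha]
  coassoc := by
    suffices h : ((Algebra.TensorProduct.assoc k k k R H H).toAlgHom.comp
        (Algebra.TensorProduct.map D (AlgHom.id k H))).comp D =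
        (Algebra.TensorProduct.map (AlgHom.id k R) (Bialgebra.comulAlgHom k H)).comp D from
      fun r => congr($h r)
    refine AlgHom.ext_of_adjoin_eq_top hgen ?_
    rintro _ (⟨x, rfl⟩ | ha)
    · have h1 (t : S ⊗[k] H) : Algebra.TensorProduct.assoc k k k R H H
          (Algebra.TensorProduct.map D (AlgHom.id k H)
            (Algebra.TensorProduct.map j (AlgHom.id k H) t)) =
          Algebra.TensorProduct.map j (AlgHom.id k (H ⊗[k] H))
            (Algebra.TensorProduct.assoc k k k S H H
              (Algebra.TensorProduct.map δ.del (AlgHom.id k H) t)) := by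
        induction t with
        | zero => simp
        | add x y hx hy => simp_all
        | tmul x y =>
          simp only [Algebra.TensorProduct.map_tmul, hj]
          induction δ.del x with
          | zero => simp
          | add x y hx hy => simp_all [TensorProduct.add_tmul]
          | tmul x y => simp
      have h2 (t : S ⊗[k] H) : Algebra.TensorProduct.map (AlgHom.id k R)
          (Bialgebra.comulAlgHom k H) (Algebra.TensorProduct.map j (AlgHom.id k H) t) =
          Algebra.TensorProduct.map j (AlgHom.id k (H ⊗[k] H))
            (Algebra.TensorProduct.map (AlgHom.id k S) (Bialgebra.comulAlgHom k H) t) := by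
        induction t with
        | zero => simp
        | add x y hx hy => simp_all
        | tmul x y => simp
      change Algebra.TensorProduct.assoc k k k R H H
          (Algebra.TensorProduct.map D (AlgHom.id k H) (D (j x))) =
        Algebra.TensorProduct.map (AlgHom.id k R) (Bialgebra.comulAlgHom k H) (D (j x))
      rw [hj, h1, h2, δ.coassoc]
    · simp [hs _ ha, Algebra.TensorProduct.one_def]

end Generated

section BaseChange

variable {M : Type w} [Field M] [Algebra M K] [Algebra k M] [IsScalarTower k M K]
  (hM : ∀ c : M, algebraMap M K c ∈ δ.constants) (A : Type w) [CommRing A] [Algebra M A]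

/-- The coaction on `K ⊗ A` that is trivial on `A`. -/
noncomputable def tensorDel : K ⊗[M] A →ₐ[k] (K ⊗[M] A) ⊗[k] H :=
  (Algebra.TensorProduct.lift
    { toRingHom := ((Algebra.TensorProduct.map (includeLeft : K →ₐ[k] K ⊗[M] A)
        (AlgHom.id k H)).comp δ.del).toRingHom
      -- Linearity over `M` is the point where the elements of `M` have to be constants.
      commutes' := fun c : M => by
        change Algebra.TensorProduct.map includeLeft (AlgHom.id k H) (δ.del (algebraMap M K c)) = _
        rw [δ.mem_constants.mp (hM c)]
        rfl }
    ((includeLeft : K ⊗[M] A →ₐ[M] (K ⊗[M] A) ⊗[k] H).comp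
      includeRight) fun _ _ => .all _ _).restrictScalars k

theorem tensorDel_tmul (x : K) (a : A) : δ.tensorDel hM A (x ⊗ₜ a) =
    Algebra.TensorProduct.map (includeLeft : K →ₐ[k] K ⊗[M] A) (AlgHom.id k H)
      (δ.del x) * (1 ⊗ₜ a) ⊗ₜ 1 := rfl

theorem tensorDel_includeLeft (x : K) :
    δ.tensorDel hM A ((includeLeft : K →ₐ[k] K ⊗[M] A) x) =
    Algebra.TensorProduct.map (includeLeft : K →ₐ[k] K ⊗[M] A) (AlgHom.id k H) (δ.del x) :=
  mul_one (Algebra.TensorProduct.map (includeLeft : K →ₐ[k] K ⊗[M] A) (AlgHom.id k H) (δ.del x))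

theorem tensorDel_one_tmul (a : A) : δ.tensorDel hM A (1 ⊗ₜ a) = (1 ⊗ₜ a) ⊗ₜ 1 := by
  rw [tensorDel_tmul, map_one, map_one, one_mul]

omit [Algebra k M] [IsScalarTower k M K] in
theorem adjoin_range_includeLeft_union [SMulCommClass M k K] :
    Algebra.adjoin k (Set.range (includeLeft : K →ₐ[k] K ⊗[M] A) ∪
      Set.range fun a : A => (1 : K) ⊗ₜ[M] a) = ⊤ := by
  refine eq_top_iff.mpr fun t _ => ?_
  induction t with
  | zero => exact zero_mem _
  | add x y hx hy => exact add_mem (hx trivial) (hy trivial)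
  | tmul x a =>
    have h : x ⊗ₜ[M] a = (includeLeft : K →ₐ[k] K ⊗[M] A) x * (1 : K) ⊗ₜ[M] a := by simp
    rw [h]
    exact mul_mem (Algebra.subset_adjoin (.inl ⟨x, rfl⟩)) (Algebra.subset_adjoin (.inr ⟨a, rfl⟩))

/-- The action on `K ⊗ A` that is trivial on `A`. -/
noncomputable def tensor : Action k H (K ⊗[M] A) :=
  δ.ofGenerated includeLeft _ (adjoin_range_includeLeft_union A) (δ.tensorDel hM A)
    (δ.tensorDel_includeLeft hM A) (by rintro _ ⟨a, rfl⟩; exact δ.tensorDel_one_tmul hM A a)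

end BaseChange

end Action

/-! ### Transfer of constant solutions by existential closedness -/

section ModelTheory

open FirstOrder Language

variable {k : Type u} [Field k] {H : Type v} [CommRing H] [HopfAlgebra k H] {d : ℕ}

/-- The coordinates of the operators on a constant are those of `1`. -/
theorem Action.del_eq_tmul_one_iff (b : Module.Basis (Fin (d + 1)) k H)
    (hb0 : Coalgebra.counit (R := k) (b 0) = 1)
    (hb : ∀ i : Fin d, Coalgebra.counit (R := k) (b i.succ) = 0)
    {R : Type w} [CommRing R] [Algebra k R] (δ : Action k H R) (x : R) :
    δ.del x = x ⊗ₜ[k] (1 : H) ↔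
      ∀ i : Fin d, δ.op b i.succ x = algebraMap k R (b.repr 1 i.succ) * x := by
  let B := Algebra.TensorProduct.basis R b
  have hB (i) : B.repr (x ⊗ₜ[k] (1 : H)) i = algebraMap k R (b.repr 1 i) * x := by
    simp [B, mul_comm]
  have hc (t : R ⊗[k] H) : Algebra.TensorProduct.rid k k R
      (Algebra.TensorProduct.map (AlgHom.id k R) (Bialgebra.counitAlgHom k H) t) =
      B.repr t 0 := by
    induction t with
    | zero => simp
    | add x y hx hy => simp_all
    | tmul r h =>
      have : Coalgebra.counit (R := k) h = b.repr h 0 := by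
        conv_lhs => rw [← b.sum_repr h]
        rw [map_sum, Fin.sum_univ_succ]
        simp [hb0, hb]
      simp [B, this, Algebra.smul_def, mul_comm]
  constructor
  · intro h i
    rw [Action.op, h]
    exact hB _
  · intro h
    refine B.repr.injective (Finsupp.ext fun i => ?_)
    refine Fin.cases ?_ (fun i => ?_) i
    -- The counit reads off the coordinate at `b 0`, so the counit axiom settles index `0`, which
    -- has no function symbol.
    · rw [← hc, ← hc, δ.counit_del]
      simp
    · rw [hB]
      exact h i

/-- Polynomials are terms. -/
theorem exists_term_realize_eq (b : Module.Basis (Fin (d + 1)) k H)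
    {K : Type w} [CommRing K] [Algebra k K] {n : ℕ} (p : MvPolynomial (Fin n) K) :
    ∃ t : (language k d).Term (K ⊕ Fin n), ∀ (L : Type w) [CommRing L] [Algebra k L]
      (ε : Action k H L) (f : K →ₐ[k] L) (y : Fin n → L),
      @Term.realize _ L (structureOf b ε) _ (Sum.elim f y) t =
        MvPolynomial.eval₂ (f : K →+* L) y p := by
  induction p using MvPolynomial.induction_on with
  | C a => exact ⟨Term.var (.inl a), by intros; simp⟩
  | add p q hp hq =>
    obtain ⟨s, hs⟩ := hp
    obtain ⟨t, ht⟩ := hq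
    refine ⟨Functions.apply₂ (L := language k d) (Sum.inl Ring.addFunc) s t, ?_⟩
    intro L _ _ ε f y
    rw [MvPolynomial.eval₂_add, ← hs L ε, ← ht L ε]
    rfl
  | mul_X p i hp =>
    obtain ⟨s, hs⟩ := hp
    refine ⟨Functions.apply₂ (L := language k d) (Sum.inl Ring.mulFunc) s (Term.var (.inr i)), ?_⟩
    intro L _ _ ε f y
    rw [MvPolynomial.eval₂_mul, MvPolynomial.eval₂_X, ← hs L ε]
    rfl

theorem _root_.FirstOrder.Language.BoundedFormula.IsQF.iInf {L : Language} {α β : Type*}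
    [Finite β] {n : ℕ} {φ : β → L.BoundedFormula α n} (h : ∀ i, (φ i).IsQF) :
    (BoundedFormula.iInf φ).IsQF := by
  let _ := Fintype.ofFinite β
  change (((Finset.univ : Finset β).toList.map φ).foldr (· ⊓ ·) ⊤).IsQF
  induction (Finset.univ : Finset β).toList with
  | nil => exact .top
  | cons i l ih => exact (h i).inf ih

/-- In an existentially closed field with an action, a system of polynomial equations that has a
solution among the constants of an extension has a solution among the constants. -/
theorem IsExistentiallyClosed.exists_mem_constants {b : Module.Basis (Fin (d + 1)) k H}
    (hb0 : Coalgebra.counit (R := k) (b 0) = 1)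
    (hb : ∀ i : Fin d, Coalgebra.counit (R := k) (b i.succ) = 0)
    {K : Type w} [Field K] [Algebra k K] {δ : Action k H K} (hK : IsExistentiallyClosed b δ)
    {L : Type w} [Field L] [Algebra k L] {ε : Action k H L} {f : K →ₐ[k] L}
    (hf : IsEquivariant δ ε f) {n : ℕ} (s : Finset (MvPolynomial (Fin n) K)) (y : Fin n → L)
    (hy : ∀ i, y i ∈ ε.constants) (hs : ∀ p ∈ s, MvPolynomial.eval₂ (f : K →+* L) y p = 0) :
    ∃ x : Fin n → K, (∀ i, x i ∈ δ.constants) ∧ ∀ p ∈ s, MvPolynomial.eval x p = 0 := by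
  choose t ht using fun p : MvPolynomial (Fin n) K => exists_term_realize_eq (d := d) b p
  -- The term `t 0` stands for zero. The other equations say that each variable is a constant; the
  -- coordinates of `1` enter because `b 0` need not be `1`.
  let φ : s ⊕ (Fin n × Fin d) → (language k d).Formula (K ⊕ Fin n) := Sum.elim
    (fun p => (t p).equal (t 0))
    fun li => (Functions.apply₁ (L := language k d) (Sum.inr (OpFunctions.op li.2))
      (Term.var (.inr li.1))).equal
      (t (MvPolynomial.C (algebraMap k K (b.repr 1 li.2.succ)) * MvPolynomial.X li.1))
  have hφ (L : Type w) [Field L] [Algebra k L] (ε : Action k H L) (f : K →ₐ[k] L)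
      (y : Fin n → L) :
      @Formula.Realize _ L (structureOf b ε) _ (Formula.iInf φ) (Sum.elim f y) ↔
        (∀ p ∈ s, MvPolynomial.eval₂ (f : K →+* L) y p = 0) ∧ ∀ i, y i ∈ ε.constants := by
    let _ := structureOf b ε
    rw [Formula.realize_iInf, Sum.forall]
    refine and_congr ?_ ?_
    · simp only [φ, Sum.elim_inl, Formula.realize_equal, Subtype.forall]
      refine forall₂_congr fun p _ => ?_
      rw [ht p L ε, ht 0 L ε, MvPolynomial.eval₂_zero]
    · simp only [φ, Sum.elim_inr, Formula.realize_equal, Prod.forall]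
      refine forall_congr' fun l => ?_
      rw [Action.mem_constants, Action.del_eq_tmul_one_iff b hb0 hb]
      refine forall_congr' fun i => ?_
      rw [ht _ L ε, MvPolynomial.eval₂_mul, MvPolynomial.eval₂_C, MvPolynomial.eval₂_X]
      simp only [RingHom.coe_coe, AlgHom.commutes]
      rfl
  obtain ⟨x, hx⟩ := hK L ε f hf n (Formula.iInf φ)
    (.iInf (by rintro (p | li) <;> exact (BoundedFormula.IsAtomic.equal _ _).isQF))
    ⟨y, (hφ L ε f y).mpr ⟨hs, hy⟩⟩
  obtain ⟨h1, h2⟩ := (hφ K δ (AlgHom.id k K) x).mp hx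
  exact ⟨x, h2, h1⟩

/-- The action on the domain `R` extends to its fraction field, which is then an extension of `K`
among the fields with an action. -/
theorem IsExistentiallyClosed.exists_mem_constants_of_isDomain
    {b : Module.Basis (Fin (d + 1)) k H} (hb0 : Coalgebra.counit (R := k) (b 0) = 1)
    (hb : ∀ i : Fin d, Coalgebra.counit (R := k) (b i.succ) = 0)
    {K : Type w} [Field K] [Algebra k K] {δ : Action k H K} (hK : IsExistentiallyClosed b δ)
    {R : Type w} [CommRing R] [IsDomain R] [Algebra k R] {ρ : Action k H R} {f : K →ₐ[k] R}
    (hf : IsEquivariant δ ρ f) {n : ℕ} (s : Finset (MvPolynomial (Fin n) K)) (y : Fin n → R)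
    (hy : ∀ i, ρ.del (y i) = y i ⊗ₜ 1) (hs : ∀ p ∈ s, MvPolynomial.eval₂ (f : K →+* R) y p = 0) :
    ∃ x : Fin n → K, (∀ i, x i ∈ δ.constants) ∧ ∀ p ∈ s, MvPolynomial.eval x p = 0 := by
  have : Module.Finite k H := .of_basis b
  let L := FractionRing R
  let j : R →ₐ[k] L := IsScalarTower.toAlgHom k R L
  have hj (r : R) : (ρ.fractionField L).del (j r) =
      Algebra.TensorProduct.map j (AlgHom.id k H) (ρ.del r) :=
    ρ.fractionField_del_algebraMap L r
  have hfj : IsEquivariant δ (ρ.fractionField L) (j.comp f) := fun x => by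
    rw [AlgHom.comp_apply, hj, hf, ← AlgHom.comp_apply, ← Algebra.TensorProduct.map_comp,
      AlgHom.id_comp]
  refine hK.exists_mem_constants hb0 hb hfj s (fun i => j (y i)) (fun i => ?_) fun p hp => ?_
  · rw [Action.mem_constants, hj, hy, Algebra.TensorProduct.map_tmul, map_one]
  · have h := congr(j $(hs p hp))
    rw [map_zero, ← AlgHom.coe_toRingHom, MvPolynomial.hom_eval₂] at h
    exact h

/-- An affine variety over a field `M` of constants of an existentially closed field `K` with an
action has a point in the constants if it is integral over `K`. -/
theorem IsExistentiallyClosed.exists_eval₂_eq_zero {b : Module.Basis (Fin (d + 1)) k H}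
    (hb0 : Coalgebra.counit (R := k) (b 0) = 1)
    (hb : ∀ i : Fin d, Coalgebra.counit (R := k) (b i.succ) = 0)
    {K : Type w} [Field K] [Algebra k K] {δ : Action k H K} (hK : IsExistentiallyClosed b δ)
    {M : Type w} [Field M] [Algebra M K] [Algebra k M] [IsScalarTower k M K]
    (hM : ∀ c : M, algebraMap M K c ∈ δ.constants) {n : ℕ} (I : Ideal (MvPolynomial (Fin n) M))
    [IsDomain (K ⊗[M] (MvPolynomial (Fin n) M ⧸ I))] :
    ∃ x : Fin n → K, (∀ i, x i ∈ δ.constants) ∧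
      ∀ p ∈ I, MvPolynomial.eval₂ (algebraMap M K) x p = 0 := by
  let A := MvPolynomial (Fin n) M ⧸ I
  let f : K →ₐ[k] K ⊗[M] A := Algebra.TensorProduct.includeLeft
  let y : Fin n → K ⊗[M] A := fun i => 1 ⊗ₜ Ideal.Quotient.mk I (MvPolynomial.X i)
  have hy (p : MvPolynomial (Fin n) M) :
      MvPolynomial.eval₂ (algebraMap K (K ⊗[M] A)) y (MvPolynomial.map (algebraMap M K) p) =
        1 ⊗ₜ Ideal.Quotient.mk I p := by
    have h : MvPolynomial.aeval y =
        (Algebra.TensorProduct.includeRight : A →ₐ[M] K ⊗[M] A).comp (Ideal.Quotient.mkₐ M I) :=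
      MvPolynomial.algHom_ext fun i => MvPolynomial.aeval_X y i
    rw [MvPolynomial.eval₂_map]
    exact congr($h p)
  -- Hilbert's basis theorem: a single formula can express only finitely many equations.
  obtain ⟨s, hs⟩ := (inferInstance : IsNoetherian _ (MvPolynomial (Fin n) M)).noetherian I
  classical
  obtain ⟨x, hx, hx0⟩ := hK.exists_mem_constants_of_isDomain (ρ := δ.tensor hM A) (f := f) hb0 hb
    (fun x => δ.tensorDel_includeLeft hM A x) (s.image (MvPolynomial.map (algebraMap M K))) y
    (fun _ => δ.tensorDel_one_tmul hM A _) (by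
      intro p hp
      obtain ⟨q, hq, rfl⟩ := Finset.mem_image.mp hp
      refine (hy q).trans ?_
      rw [Ideal.Quotient.eq_zero_iff_mem.mpr (hs ▸ Ideal.subset_span hq), TensorProduct.tmul_zero])
  have hle : I ≤ RingHom.ker (MvPolynomial.eval₂Hom (algebraMap M K) x) := by
    rw [← hs]
    refine Ideal.span_le.mpr fun p hp => ?_
    have := hx0 _ (Finset.mem_image_of_mem _ hp)
    rwa [MvPolynomial.eval_map] at this
  exact ⟨x, hx, fun p hp => hle hp⟩

end ModelTheory

end GroupSchemeField

theorem proposition4p6 {k : Type u} [Field k] {H : Type v} [CommRing H] [HopfAlgebra k H] {d : ℕ}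
    (b : Module.Basis (Fin (d + 1)) k H)
    (hb0 : Coalgebra.counit (R := k) (b 0) = 1)
    (hb : ∀ i : Fin d, Coalgebra.counit (R := k) (b i.succ) = 0)
    {K : Type w} [Field K] [Algebra k K] (δ : GroupSchemeField.Action k H K)
    (hK : GroupSchemeField.IsExistentiallyClosed b δ) :
    GroupSchemeField.IsPAC δ.constants := by
  intro n I hI
  have := MvPolynomial.isDomain_tensor_quotient (AlgebraicClosure δ.constants) I
  have := Algebra.TensorProduct.isDomain_of_isDomain_algebraicClosure δ.constants
    (MvPolynomial (Fin n) δ.constants ⧸ I) K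
  obtain ⟨x, hx, hx0⟩ := hK.exists_eval₂_eq_zero hb0 hb (fun c => c.2) I
  refine ⟨fun i => ⟨x i, hx i⟩, fun q hq => (algebraMap δ.constants K).injective ?_⟩
  rw [map_zero, ← hx0 q hq, MvPolynomial.eval, MvPolynomial.coe_eval₂Hom,
    MvPolynomial.hom_eval₂, RingHom.comp_id]
  rfl
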